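/- Let $X$ be a finite nonempty alphabet, let $B$ be a finite-dimensional Hilbert space, and let $W: x\mapsto\rho_x$ be a classical-quantum channel assigning to each $x\in X$ a density operator $\rho_x$ on $B$. For $\delta\ge 0$, a density operator $\rho$ and a positive semidefinite $\sigma$, put $\beta_\delta(\rho,\sigma)=\min\{\operatorname{Tr}(Q\sigma): 0\le Q\le I,\ \operatorname{Tr}(Q\rho)\ge 1-\delta\}$, and let $D_H^{\delta}(\rho\|\sigma)=-\log_2\beta_\delta(\rho,\sigma)$ be the hypothesis testing relative entropy (equal to $+\infty$ if $\beta_\delta=0$). For a probability distribution $p_X$ on $X$ let $\rho_{XB}=\sum_x p_X(x)\,|x\rangle\langle x|\otimes\rho_x$, with marginals $\rho_X$ and $\rho_B$. A code with $M\ge1$ messages consists of codewords $x_1,\dots,x_M\in X$ and a decoding POVM $\{\Lambda_m\}_{m=1}^M$ on $B$; its error probability is $\frac1M\sum_m(1-\operatorname{Tr}(\Lambda_m\rho_{x_m}))$. The $\varepsilon$-one-shot classical capacity $C^\varepsilon(W)$ is the supremum of $\log_2 M$ over all codes with error probability at most $\varepsilon$. A sequential decoder is given by a unitary $U_x$ on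 $B\otimes\mathbb C^2$ for each $x\in X$. On receiving a state $\rho$ it appends $M$ qubit probes $P_1,\dots,P_M$ in the state $|0\rangle$ and, for $i=1,2,\dots,M$ in turn, applies $U_{x_i}$ to $B\otimes P_i$ and measures $P_i$ in the computational basis; on outcome $1$ it outputs message $i$ and stops, on outcome $0$ it applies $U_{x_i}^\dagger$ and goes on to $i+1$ (declaring failure if $i=M$). With $\Pi_i=U_{x_i}^\dagger(I\otimes|1\rangle\langle1|_{P_i})U_{x_i}$, message $m$ is thus decoded correctly with probability $$\operatorname{Tr}\{\Pi_m(I-\Pi_{m-1})\cdots(I-\Pi_1)(\rho_{x_m}\otimes|0\cdots0\rangle\langle0\cdots0|)(I-\Pi_1)\cdots(I-\Pi_{m-1})\Pi_m\}.$$ Let $C^\varepsilon_{\mathrm{seq}}(W)$ be the supremum of $\log_2 M$ over all choices of $M\ge 1$, codewords and sequential decoder whose error probability, averaged uniformly over the messages, is at most $\varepsilon$. Theorem. Let $\varepsilon\ge 0$ and $0\le\varepsilon'<\varepsilon^2/4$. Then the maximum of $D_H^{\varepsilon'}(\rho_{XB}\|\rho_X\otimes\rho_B)$ over all probability distributions $p_X$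 on $X$ exists in $[0,+\infty]$, and $$C^\varepsilon(W)\ \ge\ \max_{p_X}D_H^{\varepsilon'}(\rho_{XB}\|\rho_X\otimes\rho_B)-\log_2\frac{1}{\varepsilon^2/4-\varepsilon'} .$$ The bound is achieved by sequential decoding: the same lower bound holds for $C^\varepsilon_{\mathrm{seq}}(W)$. -/

import Mathlib

open scoped Matrix Kronecker ComplexOrder

noncomputable section

namespace SeqDecoding

variable {X d : Type*} [Fintype X] [DecidableEq X] [Fintype d] [DecidableEq d]

/-- Density operators on the finite-dimensional Hilbert space `ℂ^d`. -/
def IsDensity (ρ : Matrix d d ℂ) : Prop := ρ.PosSemidef ∧ ρ.trace = 1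

/-- A classical-quantum channel `x ↦ ρ_x` with input alphabet `X` and output system `ℂ^d`. -/
structure CQChannel (X d : Type*) [Fintype d] where
  state : X → Matrix d d ℂ
  isDensity : ∀ x, IsDensity (state x)

/-- The effects `0 ≤ Q ≤ I`. -/
def IsEffect (Q : Matrix d d ℂ) : Prop := Q.PosSemidef ∧ (1 - Q).PosSemidef

/-- The optimal type-II error
`β_ε(ρ, σ) = min {Tr(Qσ) : 0 ≤ Q ≤ I, Tr(Qρ) ≥ 1 - ε}`, for `ε ≥ 0`. -/
def beta (ε : ℝ) (ρ σ : Matrix d d ℂ) : ℝ :=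
  sInf {t : ℝ | ∃ Q : Matrix d d ℂ,
    IsEffect Q ∧ 1 - ε ≤ (Q * ρ).trace.re ∧ t = (Q * σ).trace.re}

/-- The hypothesis testing relative entropy `D_H^ε(ρ‖σ) = -log₂ β_ε(ρ, σ)`, with `-log₂ 0 = ∞`. -/
def hypTestRelEntropy (ε : ℝ) (ρ σ : Matrix d d ℂ) : EReal :=
  if beta ε ρ σ = 0 then ⊤ else ((-Real.logb 2 (beta ε ρ σ) : ℝ) : EReal)

/-- The partial trace over the second tensor factor. -/
def partialTraceRight (ρ : Matrix (X × d) (X × d) ℂ) : Matrix X X ℂ :=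
  Matrix.of fun x y => ∑ a, ρ (x, a) (y, a)

/-- The partial trace over the first tensor factor. -/
def partialTraceLeft (ρ : Matrix (X × d) (X × d) ℂ) : Matrix d d ℂ :=
  Matrix.of fun a b => ∑ x, ρ (x, a) (x, b)

/-- `ρ_XB = ∑ₓ p(x) |x⟩⟨x| ⊗ ρ_x`. -/
def cqState (W : CQChannel X d) (p : X → ℝ) : Matrix (X × d) (X × d) ℂ :=
  ∑ x, (p x : ℂ) • (Matrix.single x x (1 : ℂ) ⊗ₖ W.state x)

/-- `D_H^ε(ρ_XB ‖ ρ_X ⊗ ρ_B)` for the input distribution `p`. -/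
def hypTestInformation (W : CQChannel X d) (ε : ℝ) (p : X → ℝ) : EReal :=
  hypTestRelEntropy ε (cqState W p)
    (partialTraceRight (cqState W p) ⊗ₖ partialTraceLeft (cqState W p))

/-- A POVM with outcomes `1, …, M`. -/
def IsPOVM {M : ℕ} (Λ : Fin M → Matrix d d ℂ) : Prop :=
  (∀ m, (Λ m).PosSemidef) ∧ ∑ m, Λ m = 1

/-- The average error probability, over uniformly distributed messages, of the code with
codewords `c` and decoding POVM `Λ`. -/
def avgError (W : CQChannel X d) {M : ℕ} (c : Fin M → X) (Λ : Fin M → Matrix d d ℂ) : ℝ :=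
  (∑ m, (1 - (Λ m * W.state (c m)).trace.re)) / M

/-- The `ε`-one-shot classical capacity: the largest number of bits `log₂ M` such that some code
with `M` messages has error probability at most `ε`. -/
def oneShotCapacity (W : CQChannel X d) (ε : ℝ) : EReal :=
  sSup {r : EReal | ∃ (M : ℕ) (c : Fin M → X) (Λ : Fin M → Matrix d d ℂ),
    0 < M ∧ IsPOVM Λ ∧ avgError W c Λ ≤ ε ∧ r = ((Real.logb 2 M : ℝ) : EReal)}

/-- An operator on `B ⊗ P`, `P` a qubit, regarded as an operator on `B ⊗ P₁ ⊗ ⋯ ⊗ P_M` that acts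
on `B` and the probe `P_j`, and as the identity on the other probes. -/
def onProbe {M : ℕ} (j : Fin M) (T : Matrix (d × Fin 2) (d × Fin 2) ℂ) :
    Matrix (d × (Fin M → Fin 2)) (d × (Fin M → Fin 2)) ℂ :=
  Matrix.of fun a b =>
    if ∀ k, k ≠ j → a.2 k = b.2 k then T (a.1, a.2 j) (b.1, b.2 j) else 0

/-- The projector `U† (I_B ⊗ |b⟩⟨b|_{P_j}) U`, with `U` acting on `B` and `P_j`: apply `U`, obtain
the outcome `b` when measuring the probe `P_j` in the computational basis, and undo `U`. -/
def testProj {M : ℕ} (U : Matrix (d × Fin 2) (d × Fin 2) ℂ) (j : Fin M) (b : Fin 2) :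
    Matrix (d × (Fin M → Fin 2)) (d × (Fin M → Fin 2)) ℂ :=
  (onProbe j U)ᴴ * onProbe j ((1 : Matrix d d ℂ) ⊗ₖ Matrix.single b b (1 : ℂ)) * onProbe j U

/-- The subnormalized state, starting from `ρ ⊗ |0⋯0⟩⟨0⋯0|`, after the tests for the codewords
that precede codeword `m` have been carried out in order and have all answered "no"
(outcome `0`). The test for the input symbol `x` is given by the unitary `U x`. -/
def rejectedState {M : ℕ} (c : Fin M → X) (U : X → Matrix (d × Fin 2) (d × Fin 2) ℂ)
    (ρ : Matrix d d ℂ) (m : Fin M) :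
    Matrix (d × (Fin M → Fin 2)) (d × (Fin M → Fin 2)) ℂ :=
  ((List.finRange M).take m).foldl
    (fun σ j => testProj (U (c j)) j 0 * σ * testProj (U (c j)) j 0)
    (ρ ⊗ₖ Matrix.single (0 : Fin M → Fin 2) 0 (1 : ℂ))

/-- The probability that the sequential decoder outputs `m` on input state `ρ`: the first "yes"
(outcome `1`) comes from the test for codeword `m`. -/
def seqProb {M : ℕ} (c : Fin M → X) (U : X → Matrix (d × Fin 2) (d × Fin 2) ℂ)
    (ρ : Matrix d d ℂ) (m : Fin M) : ℝ :=
  (testProj (U (c m)) m 1 * rejectedState c U ρ m * testProj (U (c m)) m 1).trace.re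

/-- The average error probability of the code with codewords `c` and the sequential decoder given
by the unitaries `U`. -/
def seqAvgError (W : CQChannel X d) {M : ℕ} (c : Fin M → X)
    (U : X → Matrix (d × Fin 2) (d × Fin 2) ℂ) : ℝ :=
  (∑ m, (1 - seqProb c U (W.state (c m)) m)) / M

/-- The largest number of bits `log₂ M` that can be sent with error probability at most `ε` by
codes with a sequential decoder. -/
def seqOneShotCapacity (W : CQChannel X d) (ε : ℝ) : EReal :=
  sSup {r : EReal | ∃ (M : ℕ) (c : Fin M → X) (U : X → Matrix (d × Fin 2) (d × Fin 2) ℂ),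
    0 < M ∧ (∀ x, U x ∈ Matrix.unitaryGroup (d × Fin 2) ℂ) ∧ seqAvgError W c U ≤ ε ∧
      r = ((Real.logb 2 M : ℝ) : EReal)}

end SeqDecoding

end

open scoped Matrix Kronecker ComplexOrder

namespace SeqDecoding

/-! ### Effects, square roots and the noncommutative union bound. -/

section MatrixLemmas

/-! Take an input distribution `p` and a test `Q` for ρ_XB against ρ_X ⊗ ρ_B with type-II error β.
Both states are block diagonal, so `Q` matters only through its blocks `Q_x`, effects on B that ask
whether the codeword was `x`. Each `Q_x` is realised by a rotation of a probe qubit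
(`exists_unitary_dilation`), which makes the test a projection on a larger space. The noncommutative
union bound then controls the disturbance caused by successive tests: message `m` is missed with
probability at most 4 times the sum of the rejection probability of test `m` and the acceptance
probabilities of the earlier tests (`one_sub_seqProb_le`). For random codewords this averages to at
most 4(ε' + (M - 1)β), so some codebook does as well (`exists_codebook`). The choice M = ⌈(ε²/4 -
ε')/β⌉ makes the error at most ε², hence at most ε if ε ≤ 1; for ε ≥ 1 there is nothing to prove. If
β = 0, every M is admissible. The optimal `p` and `Q` exist by compactness (`exists_optimal_test`),
and completing the decoder to a POVM gives the bound for the ordinary capacity. -/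

lemma isClosed_posSemidef {n : Type*} [Fintype n] : IsClosed {Q : Matrix n n ℂ | Q.PosSemidef} := by
  simp only [Matrix.posSemidef_iff_dotProduct_mulVec, Set.ofPred_and, Set.ofPred_forall]
  refine IsClosed.inter ?_ (isClosed_iInter fun x => ?_)
  · exact isClosed_eq (by fun_prop) continuous_id
  · exact isClosed_le continuous_const (by fun_prop)

variable {n : Type*} [Fintype n] [DecidableEq n]

open scoped MatrixOrder in
/-- A positive semidefinite matrix is of the form `Bᴴ * B`. -/
lemma exists_conjTranspose_mul_self {P : Matrix n n ℂ} (hP : P.PosSemidef) :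
    ∃ B : Matrix n n ℂ, P = Bᴴ * B :=
  CStarAlgebra.nonneg_iff_eq_star_mul_self.mp hP.nonneg

lemma trace_mul_re_nonneg {P Q : Matrix n n ℂ} (hP : P.PosSemidef) (hQ : Q.PosSemidef) :
    0 ≤ (P * Q).trace.re := by
  obtain ⟨B, rfl⟩ := exists_conjTranspose_mul_self hQ
  rw [← Matrix.mul_assoc, Matrix.trace_mul_comm, ← Matrix.mul_assoc]
  exact (Complex.le_def.mp (hP.mul_mul_conjTranspose_same B).trace_nonneg).1

/-- An effect `Q` has commuting Hermitian square roots `S` of `Q` and `C` of `1 - Q`. -/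
lemma exists_commuting_sqrt {Q : Matrix n n ℂ} (hQ : IsEffect Q) :
    ∃ C S : Matrix n n ℂ, Cᴴ = C ∧ Sᴴ = S ∧ C * S = S * C ∧ C * C + S * S = 1 ∧ S * S = Q := by
  have hsa : IsSelfAdjoint Q := hQ.1.isHermitian.isSelfAdjoint
  have h0 : ∀ x ∈ spectrum ℝ Q, 0 ≤ x :=
    fun x hx => by
      simpa using (Matrix.posSemidef_iff_isHermitian_and_spectrum_nonneg.mp hQ.1).2 hx
  have h1 : ∀ x ∈ spectrum ℝ Q, x ≤ 1 := by
    intro x hx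
    have h := (Matrix.posSemidef_iff_isHermitian_and_spectrum_nonneg.mp hQ.2).2
    have hx' : 1 - x ∈ spectrum ℝ (1 - Q) := by
      rw [← map_one (algebraMap ℝ (Matrix n n ℂ)), ← spectrum.singleton_sub_eq]
      exact ⟨1, rfl, x, hx, rfl⟩
    have h' : (x : ℂ) ≤ 1 := by simpa using h hx'
    exact_mod_cast h'
  have hS : cfc Real.sqrt Q * cfc Real.sqrt Q = Q := by
    rw [← cfc_mul Real.sqrt Real.sqrt Q]
    conv_rhs => rw [← cfc_id ℝ Q]
    exact cfc_congr fun x hx => by simpa using Real.mul_self_sqrt (h0 x hx)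
  have hC : cfc (fun x => Real.sqrt (1 - x)) Q * cfc (fun x => Real.sqrt (1 - x)) Q = 1 - Q := by
    rw [← cfc_mul (fun x => Real.sqrt (1 - x)) (fun x => Real.sqrt (1 - x)) Q]
    have : (1 : Matrix n n ℂ) - Q = cfc (fun x : ℝ => 1 - x) Q := by
      rw [cfc_sub (fun _ => 1) (fun x => x) Q, cfc_const_one ℝ Q, cfc_id' ℝ Q]
    rw [this]
    exact cfc_congr fun x hx => Real.mul_self_sqrt (sub_nonneg.mpr (h1 x hx))
  refine ⟨cfc (fun x => Real.sqrt (1 - x)) Q, cfc Real.sqrt Q, ?_, ?_, ?_, ?_, hS⟩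
  · exact cfc_predicate (R := ℝ) (p := IsSelfAdjoint) _ Q
  · exact cfc_predicate (R := ℝ) (p := IsSelfAdjoint) _ Q
  · exact cfc_commute_cfc _ _ Q
  · rw [hS, hC, sub_add_cancel]

/-- The entries of an effect are bounded by `1`. -/
lemma IsEffect.norm_apply_le_one {Q : Matrix n n ℂ} (hQ : IsEffect Q) (i j : n) :
    ‖Q i j‖ ≤ 1 := by
  have hH : Qᴴ = Q := hQ.1.isHermitian
  have hH' : (1 - Q)ᴴ = 1 - Q := hQ.2.isHermitian
  -- From Q - Q² = Q(1 - Q)Q + (1 - Q)Q(1 - Q). On the diagonal this bounds the squared norm of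
  -- column j by Q j j ≤ 1.
  have hsq : (Q - Qᴴ * Q).PosSemidef := by
    have h1 := hQ.2.conjTranspose_mul_mul_same Q
    have h2 := hQ.1.conjTranspose_mul_mul_same (1 - Q)
    convert h1.add h2 using 1
    rw [hH', hH]
    noncomm_ring
  have h1 := (Complex.le_def.mp (hsq.diag_nonneg (i := j))).1
  have h2 := (Complex.le_def.mp (hQ.2.diag_nonneg (i := j))).1
  simp only [Matrix.sub_apply, Matrix.one_apply_eq, Complex.sub_re, Complex.zero_re,
    Complex.one_re, sub_nonneg, Matrix.mul_apply, Complex.re_sum, Matrix.conjTranspose_apply] at h1 h2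
  have h3 : ∀ k, (star (Q k j) * Q k j).re = ‖Q k j‖ ^ 2 := by
    intro k
    rw [← Complex.normSq_eq_norm_sq, Complex.normSq_apply]
    simp
  simp only [h3] at h1
  have h4 : ‖Q i j‖ ^ 2 ≤ ∑ k, ‖Q k j‖ ^ 2 :=
    Finset.single_le_sum (f := fun k => ‖Q k j‖ ^ 2) (fun k _ => by positivity) (Finset.mem_univ i)
  exact (sq_le_one_iff₀ (norm_nonneg _)).mp (h4.trans (h1.trans h2))

lemma isCompact_isEffect : IsCompact {Q : Matrix n n ℂ | IsEffect Q} := by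
  have hK : IsCompact (Set.univ.pi fun _ : n => Set.univ.pi fun _ : n =>
      Metric.closedBall (0 : ℂ) 1) :=
    isCompact_univ_pi fun _ => isCompact_univ_pi fun _ => isCompact_closedBall _ _
  refine IsCompact.of_isClosed_subset (X := Matrix n n ℂ) hK ?_ ?_
  · exact isClosed_posSemidef.inter (isClosed_posSemidef.preimage (by fun_prop))
  · intro Q hQ i _ j _
    simpa using hQ.norm_apply_le_one i j

/-- The product `Pₖ ⋯ P₂ P₁` of a list of matrices `[P₁, …, Pₖ]`. -/
def revProd (L : List (Matrix n n ℂ)) : Matrix n n ℂ :=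
  L.foldl (fun A P => P * A) 1

lemma revProd_append_singleton (L : List (Matrix n n ℂ)) (P : Matrix n n ℂ) :
    revProd (L ++ [P]) = P * revProd L := by
  simp [revProd]

/-- Turns the step-by-step state update of `rejectedState` into conjugation by one operator. -/
lemma foldl_sandwich {ι : Type*} (P : ι → Matrix n n ℂ) (hP : ∀ i, (P i)ᴴ = P i)
    (l : List ι) (σ : Matrix n n ℂ) :
    l.foldl (fun σ j => P j * σ * P j) σ = revProd (l.map P) * σ * (revProd (l.map P))ᴴ := by
  induction l using List.reverseRecOn with
  | nil => simp [revProd]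
  | append_singleton l i ih =>
    rw [List.foldl_append, ih, List.map_append, List.map_singleton, revProd_append_singleton]
    simp [Matrix.mul_assoc, hP]

/-- The noncommutative union bound: for orthogonal projections `P₁, …, Pₖ` and `A = Pₖ ⋯ P₁`,
one has `1 - A† A ≤ 4 ∑ᵢ (1 - Pᵢ)`. -/
theorem noncommutative_union_bound (L : List (Matrix n n ℂ))
    (hL : ∀ P ∈ L, Pᴴ = P ∧ P * P = P) :
    (4 • (L.map fun P => 1 - P).sum - (1 - (revProd L)ᴴ * revProd L)).PosSemidef := by
  -- A strengthening that survives induction: with A the product and S the sum of the complements,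
  -- 4S + (1 - A†A) - 2((1 - A) + (1 - A)†) ≥ 0. Appending P adds exactly |(1 - P)(2 - A)|², where
  -- |T|² = T†T.
  have key : (4 • (L.map fun P => 1 - P).sum + (1 - (revProd L)ᴴ * revProd L)
      - 2 • ((1 - revProd L) + (1 - revProd L)ᴴ)).PosSemidef := by
    induction L using List.reverseRecOn with
    | nil => simpa [revProd] using Matrix.PosSemidef.zero
    | append_singleton L P ih =>
      have ih := ih fun P hP => hL P (by simp [hP])
      obtain ⟨hP, hP2⟩ := hL P (by simp)
      rw [revProd_append_singleton]
      generalize revProd L = A at ih ⊢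
      simp only [List.map_append, List.map_singleton, List.sum_append, List.sum_singleton]
      generalize (L.map fun P => 1 - P).sum = S at ih ⊢
      have hsq := Matrix.posSemidef_conjTranspose_mul_self (2 • (1 - P) - (1 - P) * A)
      convert ih.add hsq using 1
      have h1 : P * (P * A) = P * A := by rw [← Matrix.mul_assoc, hP2]
      simp only [Matrix.conjTranspose_sub, Matrix.conjTranspose_mul, Matrix.conjTranspose_one, hP,
        two_nsmul, Matrix.conjTranspose_add]
      simp only [Matrix.mul_sub, Matrix.sub_mul, Matrix.mul_add, Matrix.add_mul, Matrix.mul_one,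
        Matrix.one_mul, hP2, Matrix.mul_assoc, h1]
      abel
  -- Adding 2|1 - A|² cancels the terms linear in A and flips the sign of 1 - A†A.
  have hsq := Matrix.posSemidef_conjTranspose_mul_self (1 - revProd L)
  convert key.add (hsq.add hsq) using 1
  generalize revProd L = A
  simp only [Matrix.conjTranspose_sub, Matrix.conjTranspose_one, two_nsmul]
  simp only [Matrix.mul_sub, Matrix.sub_mul, Matrix.mul_one, Matrix.one_mul]
  abel

end MatrixLemmas

/-! ### Probes, the sequential decoder and its error. -/

section Decoder

variable {X d : Type*} {M : ℕ}

/-- The compression `⟨s| T |s⟩` of an operator on `ℂ^d ⊗ ℂ^κ` to an operator on `ℂ^d`. -/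
def compress {d κ : Type*} (s : κ) (T : Matrix (d × κ) (d × κ) ℂ) : Matrix d d ℂ :=
  T.submatrix (fun a => (a, s)) (fun a => (a, s))

lemma compress_one [DecidableEq d] {κ : Type*} [DecidableEq κ] (s : κ) :
    compress s (1 : Matrix (d × κ) (d × κ) ℂ) = 1 :=
  Matrix.submatrix_one _ fun _ _ h => congrArg Prod.fst h

lemma trace_mul_kronecker_single [Fintype d] {κ : Type*} [Fintype κ] [DecidableEq κ] (s : κ)
    (T : Matrix (d × κ) (d × κ) ℂ) (ρ : Matrix d d ℂ) :
    (T * (ρ ⊗ₖ Matrix.single s s (1 : ℂ))).trace = (compress s T * ρ).trace := by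
  simp [Matrix.trace, Matrix.mul_apply, compress, Fintype.sum_prod_type, Matrix.kroneckerMap_apply,
    Matrix.single_apply, ite_and]

/-- Collapses the sum over intermediate probe strings in a product of `onProbe` matrices to a sum
over a single bit. -/
lemma sum_ite_eq_off (j : Fin M) (s : Fin M → Fin 2) (f : (Fin M → Fin 2) → ℂ) :
    ∑ t, (if ∀ k, k ≠ j → s k = t k then f t else 0) = ∑ b, f (Function.update s j b) := by
  rw [← Finset.sum_filter]
  refine Finset.sum_bij' (fun t _ => t j) (fun b _ => Function.update s j b) ?_ ?_ ?_ ?_ ?_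
  · simp
  · intro b _
    simp +contextual [Function.update_of_ne]
  · intro t ht
    ext k
    by_cases hk : k = j
    · subst hk; simp
    · have := (Finset.mem_filter.mp ht).2 k hk
      simp [hk, this]
  · simp
  · intro t ht
    congr 1
    ext k
    by_cases hk : k = j
    · subst hk; simp
    · have := (Finset.mem_filter.mp ht).2 k hk
      simp [hk, this]

/-- With the next three lemmas: `onProbe j` respects products, unit, sums and adjoints, so
identities for `testProj` reduce to a single probe. -/
lemma onProbe_mul [Fintype d] (j : Fin M) (S T : Matrix (d × Fin 2) (d × Fin 2) ℂ) :
    onProbe j (S * T) = onProbe j S * onProbe j T := by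
  ext ⟨a, s⟩ ⟨b, t⟩
  simp only [onProbe, Matrix.mul_apply, Matrix.of_apply, Fintype.sum_prod_type, ite_mul, zero_mul,
    sum_ite_eq_off, Function.update_self]
  have h : ∀ e : Fin 2, (∀ k, k ≠ j → Function.update s j e k = t k) ↔
      ∀ k, k ≠ j → s k = t k := fun e =>
    forall_congr' fun k => imp_congr_right fun hk => by rw [Function.update_of_ne hk]
  simp only [h]
  split_ifs <;> simp

lemma onProbe_one [DecidableEq d] (j : Fin M) :
    onProbe j (1 : Matrix (d × Fin 2) (d × Fin 2) ℂ) = 1 := by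
  ext ⟨a, s⟩ ⟨b, t⟩
  simp only [onProbe, Matrix.of_apply, Matrix.one_apply, Prod.mk.injEq, ← ite_and]
  refine if_congr ⟨fun ⟨h, h1, h2⟩ => ⟨h1, funext fun k => ?_⟩, ?_⟩ rfl rfl
  · by_cases hk : k = j
    · rw [hk, h2]
    · exact h k hk
  · rintro ⟨rfl, rfl⟩
    simp

lemma onProbe_add (j : Fin M) (S T : Matrix (d × Fin 2) (d × Fin 2) ℂ) :
    onProbe j (S + T) = onProbe j S + onProbe j T := by
  ext a b
  simp only [onProbe, Matrix.of_apply, Matrix.add_apply]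
  split_ifs <;> simp

lemma onProbe_conjTranspose (j : Fin M) (T : Matrix (d × Fin 2) (d × Fin 2) ℂ) :
    onProbe j Tᴴ = (onProbe j T)ᴴ := by
  ext a b
  simp only [onProbe, Matrix.of_apply, Matrix.conjTranspose_apply, eq_comm (a := a.2 _)]
  split_ifs <;> simp

lemma compress_onProbe (j : Fin M) (T : Matrix (d × Fin 2) (d × Fin 2) ℂ) :
    compress 0 (onProbe j T) = compress 0 T := by
  ext a b
  simp [compress, onProbe]

variable [Fintype d] [DecidableEq d]

lemma testProj_eq_onProbe (U : Matrix (d × Fin 2) (d × Fin 2) ℂ) (j : Fin M) (b : Fin 2) :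
    testProj U j b =
      onProbe j (Uᴴ * ((1 : Matrix d d ℂ) ⊗ₖ Matrix.single b b (1 : ℂ)) * U) := by
  rw [testProj, onProbe_mul, onProbe_mul, onProbe_conjTranspose]

lemma testProj_conjTranspose (U : Matrix (d × Fin 2) (d × Fin 2) ℂ) (j : Fin M) (b : Fin 2) :
    (testProj U j b)ᴴ = testProj U j b := by
  rw [testProj_eq_onProbe, ← onProbe_conjTranspose]
  simp [Matrix.mul_assoc, Matrix.conjTranspose_kronecker, Matrix.conjTranspose_single]

lemma testProj_mul_self {U : Matrix (d × Fin 2) (d × Fin 2) ℂ}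
    (hU : U ∈ Matrix.unitaryGroup (d × Fin 2) ℂ) (j : Fin M) (b : Fin 2) :
    testProj U j b * testProj U j b = testProj U j b := by
  rw [testProj_eq_onProbe, ← onProbe_mul]
  congr 1
  have h : U * Uᴴ = 1 := Matrix.mem_unitaryGroup_iff.mp hU
  set E := (1 : Matrix d d ℂ) ⊗ₖ Matrix.single b b (1 : ℂ) with hE
  have hEE : E * E = E := by
    rw [hE, ← Matrix.mul_kronecker_mul]
    simp
  calc Uᴴ * E * U * (Uᴴ * E * U) = Uᴴ * E * (U * Uᴴ) * (E * U) := by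
        simp only [Matrix.mul_assoc]
    _ = Uᴴ * (E * E) * U := by rw [h]; simp only [Matrix.mul_assoc, Matrix.one_mul]
    _ = _ := by rw [hEE]

lemma testProj_zero_add_one {U : Matrix (d × Fin 2) (d × Fin 2) ℂ}
    (hU : U ∈ Matrix.unitaryGroup (d × Fin 2) ℂ) (j : Fin M) :
    testProj U j 0 + testProj U j 1 = 1 := by
  rw [testProj_eq_onProbe, testProj_eq_onProbe, ← onProbe_add, ← Matrix.add_mul, ← Matrix.mul_add,
    ← Matrix.kronecker_add]
  have h : Matrix.single 0 0 (1 : ℂ) + Matrix.single 1 1 (1 : ℂ) =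
      (1 : Matrix (Fin 2) (Fin 2) ℂ) := by
    ext i j
    fin_cases i <;> fin_cases j <;> simp
  rw [h, Matrix.one_kronecker_one, Matrix.mul_one, ← onProbe_one j]
  congr 1
  exact Matrix.mem_unitaryGroup_iff'.mp hU

/-- The operator `(1 - Πₖ) ⋯ (1 - Π₁)`: the first `k` tests are negative. -/
def rejectOp (c : Fin M → X) (U : X → Matrix (d × Fin 2) (d × Fin 2) ℂ) (k : ℕ) :
    Matrix (d × (Fin M → Fin 2)) (d × (Fin M → Fin 2)) ℂ :=
  revProd (((List.finRange M).take k).map fun j => testProj (U (c j)) j 0)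

/-- The operator `Πₘ (1 - Πₘ₋₁) ⋯ (1 - Π₁)`: the first positive answer comes from the test `m`. -/
def acceptOp (c : Fin M → X) (U : X → Matrix (d × Fin 2) (d × Fin 2) ℂ) (m : Fin M) :
    Matrix (d × (Fin M → Fin 2)) (d × (Fin M → Fin 2)) ℂ :=
  testProj (U (c m)) m 1 * rejectOp c U m

/-- The effect on `B` with which the sequential decoder outputs the message `m`. -/
def seqEffect (c : Fin M → X) (U : X → Matrix (d × Fin 2) (d × Fin 2) ℂ) (m : Fin M) :
    Matrix d d ℂ :=
  compress 0 ((acceptOp c U m)ᴴ * acceptOp c U m)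

lemma seqProb_eq_trace (c : Fin M → X) (U : X → Matrix (d × Fin 2) (d × Fin 2) ℂ)
    (ρ : Matrix d d ℂ) (m : Fin M) :
    seqProb c U ρ m = (seqEffect c U m * ρ).trace.re := by
  rw [seqEffect, ← trace_mul_kronecker_single, seqProb, rejectedState,
    foldl_sandwich (fun j => testProj (U (c j)) j 0) fun j => testProj_conjTranspose _ _ _]
  change (testProj (U (c m)) m 1 * (rejectOp c U m * _ * (rejectOp c U m)ᴴ) *
    testProj (U (c m)) m 1).trace.re = _
  rw [Matrix.mul_assoc (acceptOp c U m)ᴴ, Matrix.trace_mul_comm (acceptOp c U m)ᴴ, acceptOp,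
    Matrix.conjTranspose_mul, testProj_conjTranspose]
  simp only [Matrix.mul_assoc]

lemma seqEffect_posSemidef (c : Fin M → X) (U : X → Matrix (d × Fin 2) (d × Fin 2) ℂ)
    (m : Fin M) : (seqEffect c U m).PosSemidef :=
  (Matrix.posSemidef_conjTranspose_mul_self _).submatrix _

lemma rejectOp_succ (c : Fin M → X) (U : X → Matrix (d × Fin 2) (d × Fin 2) ℂ) (m : Fin M) :
    rejectOp c U (m + 1) = testProj (U (c m)) m 0 * rejectOp c U m := by
  have h : (List.finRange M).take (m + 1) = (List.finRange M).take m ++ [m] := by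
    rw [List.take_add_one]
    simp
  rw [rejectOp, h, List.map_append, List.map_singleton, revProd_append_singleton, rejectOp]

/-- The two outcomes of test `m` are complementary projections, so acceptance is a difference of
consecutive rejection terms; the sum over `m` telescopes. -/
lemma acceptOp_conjTranspose_mul_self (c : Fin M → X)
    {U : X → Matrix (d × Fin 2) (d × Fin 2) ℂ}
    (hU : ∀ x, U x ∈ Matrix.unitaryGroup (d × Fin 2) ℂ) (m : Fin M) :
    (acceptOp c U m)ᴴ * acceptOp c U m = (rejectOp c U m)ᴴ * rejectOp c U m -
      (rejectOp c U (m + 1))ᴴ * rejectOp c U (m + 1) := by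
  have key : ∀ b, (testProj (U (c m)) m b * rejectOp c U m)ᴴ *
      (testProj (U (c m)) m b * rejectOp c U m) =
      (rejectOp c U m)ᴴ * testProj (U (c m)) m b * rejectOp c U m := by
    intro b
    rw [Matrix.conjTranspose_mul, testProj_conjTranspose, Matrix.mul_assoc, Matrix.mul_assoc,
      ← Matrix.mul_assoc (testProj (U (c m)) m b), testProj_mul_self (hU _)]
  rw [rejectOp_succ, acceptOp, key, key, eq_sub_iff_add_eq, ← Matrix.add_mul, ← Matrix.mul_add,
    add_comm, testProj_zero_add_one (hU _), Matrix.mul_one]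

lemma one_sub_sum_seqEffect_posSemidef (c : Fin M → X)
    {U : X → Matrix (d × Fin 2) (d × Fin 2) ℂ}
    (hU : ∀ x, U x ∈ Matrix.unitaryGroup (d × Fin 2) ℂ) :
    (1 - ∑ m, seqEffect c U m).PosSemidef := by
  have h : ∑ m, (acceptOp c U m)ᴴ * acceptOp c U m =
      1 - (rejectOp c U M)ᴴ * rejectOp c U M := by
    simp only [acceptOp_conjTranspose_mul_self c hU]
    rw [Fin.sum_univ_eq_sum_range (fun k => (rejectOp c U k)ᴴ * rejectOp c U k -
      (rejectOp c U (k + 1))ᴴ * rejectOp c U (k + 1)), Finset.sum_range_sub']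
    simp [rejectOp, revProd]
  have h2 : 1 - ∑ m, seqEffect c U m = compress 0 ((rejectOp c U M)ᴴ * rejectOp c U M) := by
    have h3 : ∑ m, seqEffect c U m = compress 0 (1 - (rejectOp c U M)ᴴ * rejectOp c U M) := by
      rw [← h]
      ext a b
      simp [seqEffect, compress, Matrix.sum_apply]
    rw [h3, sub_eq_iff_eq_add, ← compress_one (d := d) (0 : Fin M → Fin 2)]
    ext a b
    simp [compress]
  rw [h2]
  exact (Matrix.posSemidef_conjTranspose_mul_self _).submatrix _

lemma map_take_finRange_sum {A : Type*} [AddCommMonoid A] (f : Fin M → A) (m : Fin M) :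
    (((List.finRange M).take m).map f).sum = ∑ i, if i < m then f i else 0 := by
  have hnd : ((List.finRange M).take m).Nodup := (List.nodup_finRange M).sublist
    (List.take_sublist _ _)
  rw [← List.sum_toFinset f hnd, ← Finset.sum_filter]
  refine Finset.sum_congr ?_ fun _ _ => rfl
  ext i
  simp [List.mem_take_iff_idxOf_lt (List.mem_finRange i)]

/-- If the test unitaries `U x` implement the effects `Q x`, the probability that the sequential
decoder fails to output `m` is controlled by the error probabilities of the individual tests. -/
lemma one_sub_seqProb_le (c : Fin M → X) {U : X → Matrix (d × Fin 2) (d × Fin 2) ℂ}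
    (hU : ∀ x, U x ∈ Matrix.unitaryGroup (d × Fin 2) ℂ) {Q : X → Matrix d d ℂ}
    (hQ : ∀ x, compress 0 ((U x)ᴴ * ((1 : Matrix d d ℂ) ⊗ₖ Matrix.single 1 1 (1 : ℂ)) * U x) = Q x)
    {ρ : Matrix d d ℂ} (hρ : IsDensity ρ) (m : Fin M) :
    1 - seqProb c U ρ m ≤ 4 * ((1 - (Q (c m) * ρ).trace.re) +
      ∑ i, if i < m then (Q (c i) * ρ).trace.re else 0) := by
  -- The product of this list is `acceptOp c U m`: rejection by all earlier tests, then acceptance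
  -- by test `m`.
  have hub := noncommutative_union_bound
    (((List.finRange M).take m).map (fun j => testProj (U (c j)) j 0) ++ [testProj (U (c m)) m 1])
    (by
      intro P hP
      rcases List.mem_append.mp hP with hP | hP
      · obtain ⟨j, -, rfl⟩ := List.mem_map.mp hP
        exact ⟨testProj_conjTranspose _ _ _, testProj_mul_self (hU _) _ _⟩
      · rw [List.mem_singleton.mp hP]
        exact ⟨testProj_conjTranspose _ _ _, testProj_mul_self (hU _) _ _⟩)
  rw [revProd_append_singleton] at hub
  change (_ - (1 - (acceptOp c U m)ᴴ * acceptOp c U m)).PosSemidef at hub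
  have hone : ∀ j : Fin M, 1 - testProj (U (c j)) j 0 = testProj (U (c j)) j 1 := fun j => by
    rw [← testProj_zero_add_one (hU (c j)) j, add_sub_cancel_left]
  have hsum : ((((List.finRange M).take m).map (fun j => testProj (U (c j)) j 0) ++
      [testProj (U (c m)) m 1]).map fun P => 1 - P).sum =
      (∑ i, if i < m then testProj (U (c i)) i 1 else 0) + (1 - testProj (U (c m)) m 1) := by
    rw [List.map_append, List.sum_append, List.map_map, ← map_take_finRange_sum]
    simp [Function.comp_def, hone]
  rw [hsum] at hub
  -- Compressing to all probes in |0⟩ preserves positivity and turns each test projection into its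
  -- effect `Q (c j)`; pairing with ρ then gives probabilities.
  have hcomp := hub.submatrix fun a : d => (a, (0 : Fin M → Fin 2))
  have htest : ∀ j : Fin M, compress 0 (testProj (U (c j)) j 1) = Q (c j) := fun j => by
    rw [testProj_eq_onProbe, compress_onProbe, hQ]
  have heq : ((4 • ((∑ i, if i < m then testProj (U (c i)) i 1 else 0) +
        (1 - testProj (U (c m)) m 1)) - (1 - (acceptOp c U m)ᴴ * acceptOp c U m)).submatrix
        (fun a : d => (a, (0 : Fin M → Fin 2))) fun a => (a, 0)) =
      4 • ((∑ i, if i < m then Q (c i) else 0) + (1 - Q (c m))) - (1 - seqEffect c U m) := by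
    rw [seqEffect, ← compress_one (d := d) (0 : Fin M → Fin 2)]
    simp only [← htest]
    ext a b
    simp only [compress, Matrix.sub_apply, Matrix.add_apply, Matrix.smul_apply, Matrix.sum_apply,
      Matrix.submatrix_apply]
    have hite : ∀ i, (if i < m then testProj (U (c i)) i 1 else 0) (a, 0) (b, 0) =
        (if i < m then (testProj (U (c i)) i 1).submatrix (fun a : d => (a, 0)) (fun a => (a, 0))
          else 0) a b := fun i => by
      split_ifs <;> rfl
    simp only [hite]
  rw [heq] at hcomp
  have := trace_mul_re_nonneg hcomp hρ.1
  have htr : ρ.trace.re = 1 := by rw [hρ.2, Complex.one_re]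
  rw [seqProb_eq_trace]
  have hs : ((∑ i, if i < m then Q (c i) else 0) * ρ).trace.re =
      ∑ i, if i < m then (Q (c i) * ρ).trace.re else 0 := by
    rw [Finset.sum_mul, Matrix.trace_sum, Complex.re_sum]
    refine Finset.sum_congr rfl fun i _ => ?_
    split_ifs <;> simp
  simp only [Matrix.sub_mul, Matrix.add_mul, Matrix.smul_mul, Matrix.one_mul, Matrix.trace_sub,
    Matrix.trace_add, Matrix.trace_smul, Complex.sub_re, Complex.add_re, Complex.re_nsmul,
    htr, hs] at this
  rw [nsmul_eq_mul] at this
  push_cast at this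
  linarith

/-- Every effect on `B` is implemented by a unitary on `B` and a probe qubit in the state `|0⟩`,
followed by a measurement of the probe. -/
lemma exists_unitary_dilation {Q : Matrix d d ℂ} (hQ : IsEffect Q) :
    ∃ U ∈ Matrix.unitaryGroup (d × Fin 2) ℂ,
      compress 0 (Uᴴ * ((1 : Matrix d d ℂ) ⊗ₖ Matrix.single 1 1 (1 : ℂ)) * U) = Q := by
  obtain ⟨C, S, hC, hS, hCS, hone, hSQ⟩ := exists_commuting_sqrt hQ
  -- A rotation with cosine C = √(1 - Q) and sine S = √Q: it sends ψ ⊗ |0⟩ to Cψ ⊗ |0⟩ + Sψ ⊗ |1⟩,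
  -- so outcome 1 has effect S² = Q. Unitarity uses CS = SC and C² + S² = 1.
  refine ⟨C ⊗ₖ (1 : Matrix (Fin 2) (Fin 2) ℂ) + S ⊗ₖ !![0, -1; 1, 0], ?_, ?_⟩
  · rw [Matrix.mem_unitaryGroup_iff', Matrix.star_eq_conjTranspose, Matrix.conjTranspose_add,
      Matrix.conjTranspose_kronecker, Matrix.conjTranspose_kronecker, hC, hS]
    simp only [Matrix.add_mul, Matrix.mul_add, ← Matrix.mul_kronecker_mul, hCS,
      Matrix.conjTranspose_one, Matrix.one_mul, Matrix.mul_one]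
    have h1 : (!![0, -1; 1, 0] : Matrix (Fin 2) (Fin 2) ℂ)ᴴ = - !![0, -1; 1, 0] := by
      ext i j
      fin_cases i <;> fin_cases j <;> simp
    have h2 : (!![0, -1; 1, 0] : Matrix (Fin 2) (Fin 2) ℂ) * !![0, -1; 1, 0] = -1 := by
      ext i j
      fin_cases i <;> fin_cases j <;> simp
    have h3 : ∀ (A : Matrix d d ℂ) (B : Matrix (Fin 2) (Fin 2) ℂ), A ⊗ₖ (-B) = -(A ⊗ₖ B) := by
      intro A B
      ext i j
      simp
    rw [h1, Matrix.neg_mul, h2, neg_neg, h3, ← Matrix.one_kronecker_one, ← hone,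
      Matrix.add_kronecker]
    abel
  · rw [← hSQ]
    ext a b
    have hS' : ∀ i j, star (S i j) = S j i := fun i j => congrFun (congrFun hS j) i
    simp [compress, Matrix.mul_apply, Fintype.sum_prod_type, Matrix.one_apply, Matrix.single_apply,
      hS', ite_and]

end Decoder

/-! ### Sequential decoders as POVMs. -/

section Capacity

variable {X d : Type*} [Fintype d] [DecidableEq d]

lemma one_sub_seqProb_le_one {M : ℕ} (c : Fin M → X)
    (U : X → Matrix (d × Fin 2) (d × Fin 2) ℂ) {ρ : Matrix d d ℂ} (hρ : IsDensity ρ)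
    (m : Fin M) : 1 - seqProb c U ρ m ≤ 1 := by
  rw [seqProb_eq_trace]
  linarith [trace_mul_re_nonneg (seqEffect_posSemidef c U m) hρ.1]

/-- A sequential decoder, completed by an arbitrary output in the case of failure, is a POVM. -/
lemma seqOneShotCapacity_le_oneShotCapacity (W : CQChannel X d) (ε : ℝ) :
    seqOneShotCapacity W ε ≤ oneShotCapacity W ε := by
  refine sSup_le_sSup ?_
  rintro r ⟨M, c, U, hM, hU, herr, rfl⟩
  let R : Matrix d d ℂ := 1 - ∑ m, seqEffect c U m
  have hR : R.PosSemidef := one_sub_sum_seqEffect_posSemidef c hU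
  let Λ : Fin M → Matrix d d ℂ := fun m => seqEffect c U m + if m = ⟨0, hM⟩ then R else 0
  have hite : ∀ m : Fin M, (if m = ⟨0, hM⟩ then R else 0).PosSemidef := fun m => by
    split_ifs
    exacts [hR, .zero]
  refine ⟨M, c, Λ, hM, ⟨fun m => (seqEffect_posSemidef c U m).add (hite m), ?_⟩, ?_, rfl⟩
  · simp [Λ, R, Finset.sum_add_distrib]
  · refine le_trans ?_ herr
    refine div_le_div_of_nonneg_right (Finset.sum_le_sum fun m _ => ?_) M.cast_nonneg
    have := trace_mul_re_nonneg (hite m) (W.isDensity (c m)).1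
    simp only [Λ, seqProb_eq_trace, Matrix.add_mul, Matrix.trace_add, Complex.add_re]
    linarith

end Capacity

/-! ### Random coding by averaging. -/

section Codebook

variable {X : Type*} [Fintype X]

lemma exists_le_average {p : X → ℝ} (hp : p ∈ stdSimplex ℝ X) (f : X → ℝ) :
    ∃ x, f x ≤ ∑ y, p y * f y := by
  by_contra! h
  set t := ∑ y, p y * f y with ht
  obtain ⟨x, hx⟩ : ∃ x, 0 < p x := by
    by_contra! h0
    have := Finset.sum_nonpos fun x (_ : x ∈ Finset.univ) => h0 x
    rw [hp.2] at this
    linarith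
  have h1 : ∑ y, p y * t < ∑ y, p y * f y :=
    Finset.sum_lt_sum (fun y _ => mul_le_mul_of_nonneg_left (h y).le (hp.1 y))
      ⟨x, Finset.mem_univ x, mul_lt_mul_of_pos_left (h x) hx⟩
  rw [← Finset.sum_mul, hp.2, one_mul, ← ht] at h1
  exact lt_irrefl _ h1

/-- Random coding: some codebook is at least as good as the average of the codebooks with
independent codewords of distribution `p`. -/
lemma exists_codebook {p : X → ℝ} (hp : p ∈ stdSimplex ℝ X) (b : X → X → ℝ) (M : ℕ)
    (u : X → ℝ) :
    ∃ c : Fin M → X, ∑ m, (u (c m) + ∑ i, if i < m then b (c i) (c m) else 0) ≤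
      M * (∑ x, p x * u x) + M * (M - 1) / 2 * ∑ x, p x * ∑ y, p y * b x y := by
  induction M generalizing u with
  | zero => exact ⟨Fin.elim0, by simp⟩
  | succ M ih =>
    -- Codewords are fixed one at a time. The first is charged its own cost plus its expected
    -- interference with the `M` later ones; its actual interference is then absorbed into their
    -- cost `u`, which is why `u` is generalized.
    obtain ⟨x, hx⟩ := exists_le_average hp fun x => u x + M * ∑ y, p y * b x y
    obtain ⟨c, hc⟩ := ih fun y => u y + b x y
    refine ⟨Fin.cons x c, ?_⟩
    simp only [Fin.sum_univ_succ, Fin.cons_zero, Fin.cons_succ, Fin.succ_lt_succ_iff,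
      Fin.succ_pos, if_true, Fin.not_lt_zero, lt_irrefl, if_false, Finset.sum_const_zero, add_zero]
    simp only [mul_add, Finset.sum_add_distrib, mul_left_comm (p _) (M : ℝ), ← Finset.mul_sum]
      at hx hc ⊢
    push_cast
    linarith

end Codebook

/-! ### Tests on classical-quantum states, block by block. -/

section CQState

/-- The diagonal block `⟨x| Q |x⟩` of an operator on `ℂ^X ⊗ ℂ^d`. -/
def block {X d : Type*} (Q : Matrix (X × d) (X × d) ℂ) (x : X) : Matrix d d ℂ :=
  Q.submatrix (fun a => (x, a)) (fun a => (x, a))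

lemma IsEffect.block {X d : Type*} [DecidableEq X] [DecidableEq d] {Q : Matrix (X × d) (X × d) ℂ}
    (hQ : IsEffect Q) (x : X) : IsEffect (block Q x) := by
  refine ⟨hQ.1.submatrix _, ?_⟩
  convert hQ.2.submatrix fun a => (x, a) using 1
  ext a b
  simp [SeqDecoding.block, Matrix.one_apply]

variable {X d : Type*} [Fintype X] [DecidableEq X] [Fintype d]

lemma cqState_apply (W : CQChannel X d) (p : X → ℝ) (x y : X) (a b : d) :
    cqState W p (x, a) (y, b) = if x = y then p x * W.state x a b else 0 := by
  simp only [cqState, Matrix.sum_apply, Matrix.smul_apply, Matrix.kroneckerMap_apply,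
    Matrix.single_apply, smul_eq_mul, ite_mul, zero_mul, one_mul, mul_ite, mul_zero, ite_and]
  simp

lemma partialTraceRight_cqState (W : CQChannel X d) (p : X → ℝ) :
    partialTraceRight (cqState W p) = Matrix.diagonal fun x => (p x : ℂ) := by
  ext x y
  simp only [partialTraceRight, Matrix.of_apply, cqState_apply, Matrix.diagonal_apply]
  split_ifs
  · have h : ∑ a, W.state x a a = 1 := (W.isDensity x).2
    rw [← Finset.mul_sum, h, mul_one]
  · simp

lemma partialTraceLeft_cqState (W : CQChannel X d) (p : X → ℝ) :
    partialTraceLeft (cqState W p) = ∑ x, (p x : ℂ) • W.state x := by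
  ext a b
  simp [partialTraceLeft, cqState_apply, Matrix.sum_apply]

/-- The state is block diagonal in X, so off-diagonal blocks of the test never contribute; the same
holds for the product of the marginals. -/
lemma trace_mul_cqState (W : CQChannel X d) (p : X → ℝ) (Q : Matrix (X × d) (X × d) ℂ) :
    (Q * cqState W p).trace.re = ∑ x, p x * (block Q x * W.state x).trace.re := by
  have : (Q * cqState W p).trace = ∑ x, (p x : ℂ) * (block Q x * W.state x).trace := by
    simp only [Matrix.trace, Matrix.diag_apply, Matrix.mul_apply, Fintype.sum_prod_type,
      cqState_apply, block, Matrix.submatrix_apply, Finset.mul_sum]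
    simp [Finset.sum_comm (s := (Finset.univ : Finset X)), mul_left_comm]
  rw [this]
  simp

lemma trace_mul_marginals (W : CQChannel X d) (p : X → ℝ) (Q : Matrix (X × d) (X × d) ℂ) :
    (Q * (partialTraceRight (cqState W p) ⊗ₖ partialTraceLeft (cqState W p))).trace.re =
      ∑ x, p x * ∑ y, p y * (block Q x * W.state y).trace.re := by
  rw [partialTraceRight_cqState, partialTraceLeft_cqState]
  have : ∀ σ : Matrix d d ℂ, (Q * ((Matrix.diagonal fun x => (p x : ℂ)) ⊗ₖ σ)).trace =
      ∑ x, (p x : ℂ) * (block Q x * σ).trace := by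
    intro σ
    simp only [Matrix.trace, Matrix.diag_apply, Matrix.mul_apply, Fintype.sum_prod_type,
      Matrix.kroneckerMap_apply, Matrix.diagonal_apply, block, Matrix.submatrix_apply,
      Finset.mul_sum]
    simp [mul_left_comm]
  rw [this]
  simp [Finset.mul_sum, Matrix.trace_sum]

lemma trace_mul_marginals_nonneg [DecidableEq d] (W : CQChannel X d) {p : X → ℝ}
    (hp : p ∈ stdSimplex ℝ X) {Q : Matrix (X × d) (X × d) ℂ} (hQ : IsEffect Q) :
    0 ≤ (Q * (partialTraceRight (cqState W p) ⊗ₖ partialTraceLeft (cqState W p))).trace.re := by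
  rw [trace_mul_marginals]
  exact Finset.sum_nonneg fun x _ => mul_nonneg (hp.1 x) <| Finset.sum_nonneg fun y _ =>
    mul_nonneg (hp.1 y) (trace_mul_re_nonneg (hQ.block x).1 (W.isDensity y).1)

end CQState

/-! ### Achievability, optimal tests and the final bound. -/

section Main

variable {X d : Type*} [Fintype X] [DecidableEq X] [Fintype d] [DecidableEq d]

/-- One-shot achievability by sequential decoding, for the test `Q` and the distribution `p`. -/
lemma logb_le_seqOneShotCapacity (W : CQChannel X d) {ε ε' : ℝ} (hε : 0 ≤ ε) {p : X → ℝ}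
    (hp : p ∈ stdSimplex ℝ X) {Q : Matrix (X × d) (X × d) ℂ} (hQ : IsEffect Q)
    (hQρ : 1 - ε' ≤ (Q * cqState W p).trace.re) {M : ℕ} (hM : 0 < M)
    (hMβ : ε' + (M - 1) * (Q * (partialTraceRight (cqState W p) ⊗ₖ
      partialTraceLeft (cqState W p))).trace.re ≤ ε ^ 2 / 4) :
    ((Real.logb 2 M : ℝ) : EReal) ≤ seqOneShotCapacity W ε := by
  have hβ := trace_mul_marginals_nonneg W hp hQ
  rw [trace_mul_marginals] at hMβ hβ
  rw [trace_mul_cqState] at hQρ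
  choose U hU hUQ using fun x => exists_unitary_dilation (hQ.block x)
  set b : X → X → ℝ := fun x y => (block Q x * W.state y).trace.re with hb
  obtain ⟨c, hc⟩ := exists_codebook hp b M fun x => 1 - (block Q x * W.state x).trace.re
  refine le_sSup ⟨M, c, U, hM, hU, ?_, rfl⟩
  have hM0 : (0 : ℝ) < M := by exact_mod_cast hM
  have hM1 : (1 : ℝ) ≤ M := by exact_mod_cast hM
  have h1 : seqAvgError W c U ≤ 1 := by
    rw [seqAvgError, div_le_one hM0]
    refine (Finset.sum_le_sum fun m _ =>
      one_sub_seqProb_le_one c U (W.isDensity (c m)) m).trans ?_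
    simp
  have h2 : seqAvgError W c U ≤ ε ^ 2 := by
    rw [seqAvgError, div_le_iff₀ hM0]
    refine (Finset.sum_le_sum fun m _ =>
      one_sub_seqProb_le c hU hUQ (W.isDensity (c m)) m).trans ?_
    rw [← Finset.mul_sum]
    have hu : ∑ x, p x * (1 - (block Q x * W.state x).trace.re) ≤ ε' := by
      simp only [mul_sub, Finset.sum_sub_distrib, mul_one, hp.2]
      linarith
    -- Only earlier tests interfere, so the average number of competitors is (M - 1)/2; this spare
    -- factor 1/2 is given away.
    have h3 : (M : ℝ) * (M - 1) / 2 * ∑ x, p x * ∑ y, p y * b x y ≤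
        M * ((M - 1) * ∑ x, p x * ∑ y, p y * b x y) := by
      have : 0 ≤ (M : ℝ) * ((M - 1) * ∑ x, p x * ∑ y, p y * b x y) :=
        mul_nonneg hM0.le (mul_nonneg (by linarith) hβ)
      linarith
    have h4 := mul_le_mul_of_nonneg_left hu hM0.le
    have h5 := mul_le_mul_of_nonneg_left hMβ hM0.le
    linarith
  -- ε² ≤ ε only for ε ≤ 1; beyond that the trivial bound by 1 suffices.
  rcases le_total ε 1 with h | h
  · exact h2.trans (by nlinarith)
  · exact h1.trans h

/-- The pair of an optimal input distribution and an optimal test for it. -/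
lemma exists_optimal_test [Nonempty X] (W : CQChannel X d) {ε' : ℝ} (hε' : 0 ≤ ε') :
    ∃ p ∈ stdSimplex ℝ X, ∃ Q : Matrix (X × d) (X × d) ℂ, IsEffect Q ∧
      1 - ε' ≤ (Q * cqState W p).trace.re ∧
      (Q * (partialTraceRight (cqState W p) ⊗ₖ partialTraceLeft (cqState W p))).trace.re =
        beta ε' (cqState W p)
          (partialTraceRight (cqState W p) ⊗ₖ partialTraceLeft (cqState W p)) ∧
      ∀ q ∈ stdSimplex ℝ X, beta ε' (cqState W p)
          (partialTraceRight (cqState W p) ⊗ₖ partialTraceLeft (cqState W p)) ≤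
        beta ε' (cqState W q)
          (partialTraceRight (cqState W q) ⊗ₖ partialTraceLeft (cqState W q)) := by
  let g : (X → ℝ) × Matrix (X × d) (X × d) ℂ → ℝ := fun z =>
    (z.2 * (partialTraceRight (cqState W z.1) ⊗ₖ partialTraceLeft (cqState W z.1))).trace.re
  -- Distribution and test are minimised jointly over a compact set. One minimiser yields both an
  -- attained β at `p` and the optimality of `p`.
  let K : Set ((X → ℝ) × Matrix (X × d) (X × d) ℂ) :=
    (stdSimplex ℝ X ×ˢ {Q | IsEffect Q}) ∩ {z | 1 - ε' ≤ (z.2 * cqState W z.1).trace.re}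
  have hblock : ∀ x : X, Continuous fun z : (X → ℝ) × Matrix (X × d) (X × d) ℂ => block z.2 x :=
    fun x => continuous_snd.matrix_submatrix _ _
  have htr : ∀ x y : X, Continuous fun z : (X → ℝ) × Matrix (X × d) (X × d) ℂ =>
      (block z.2 x * W.state y).trace.re := fun x y =>
    Complex.continuous_re.comp ((hblock x).matrix_mul continuous_const).matrix_trace
  have hg : Continuous g := by
    simp only [g, trace_mul_marginals]
    have := htr
    fun_prop
  have hcompact : IsCompact K := by
    refine ((isCompact_stdSimplex ℝ X).prod isCompact_isEffect).inter_right ?_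
    refine isClosed_le continuous_const ?_
    simp only [trace_mul_cqState]
    have := htr
    fun_prop
  -- The test that always accepts is feasible for every distribution, since ε' ≥ 0.
  have hone : ∀ q ∈ stdSimplex ℝ X, (q, (1 : Matrix (X × d) (X × d) ℂ)) ∈ K := by
    intro q hq
    have h1 : ∀ x : X, block (1 : Matrix (X × d) (X × d) ℂ) x = 1 := fun x =>
      Matrix.submatrix_one _ fun _ _ h => congrArg Prod.snd h
    refine ⟨⟨hq, .one, ?_⟩, ?_⟩
    · rw [sub_self]
      exact .zero
    · change 1 - ε' ≤ _
      rw [trace_mul_cqState]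
      simp only [h1, Matrix.one_mul, (W.isDensity _).2, Complex.one_re, mul_one, hq.2]
      linarith
  have hne : K.Nonempty := by
    classical
    obtain ⟨x⟩ := ‹Nonempty X›
    exact ⟨_, hone _ (single_mem_stdSimplex ℝ x)⟩
  obtain ⟨⟨p, Q⟩, ⟨⟨hp, hQ⟩, hQρ⟩, hmin⟩ := hcompact.exists_isMinOn hne hg.continuousOn
  have hle : ∀ q ∈ stdSimplex ℝ X, g (p, Q) ≤ beta ε' (cqState W q)
      (partialTraceRight (cqState W q) ⊗ₖ partialTraceLeft (cqState W q)) := by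
    intro q hq
    refine le_csInf ⟨_, 1, (hone q hq).1.2, (hone q hq).2, rfl⟩ ?_
    rintro t ⟨R, hR, hRρ, rfl⟩
    exact hmin (a := (q, R)) ⟨⟨hq, hR⟩, hRρ⟩
  have heq : g (p, Q) = beta ε' (cqState W p)
      (partialTraceRight (cqState W p) ⊗ₖ partialTraceLeft (cqState W p)) := by
    refine (hle p hp).antisymm (csInf_le ⟨0, ?_⟩ ⟨Q, hQ, hQρ, rfl⟩)
    rintro t ⟨R, hR, -, rfl⟩
    exact trace_mul_marginals_nonneg W hp hR
  exact ⟨p, hp, Q, hQ, hQρ, heq, fun q hq => heq ▸ hle q hq⟩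

/-- The value ⊤ at β = 0 extends the antitonicity of -log₂ to all β ≥ 0. The hypothesis `h0` keeps
away from negative arguments, where `Real.logb` uses the absolute value. -/
lemma hypTestRelEntropy_le_of_beta_le {n m : Type*} [Fintype n] [DecidableEq n] [Fintype m]
    [DecidableEq m] {ε : ℝ} {ρ σ : Matrix n n ℂ} {ρ' σ' : Matrix m m ℂ} (h0 : 0 ≤ beta ε ρ σ)
    (h : beta ε ρ σ ≤ beta ε ρ' σ') :
    hypTestRelEntropy ε ρ' σ' ≤ hypTestRelEntropy ε ρ σ := by
  rw [hypTestRelEntropy, hypTestRelEntropy]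
  rcases h0.eq_or_lt with h0 | h0
  · rw [if_pos h0.symm]
    exact le_top
  · rw [if_neg h0.ne', if_neg (h0.trans_le h).ne']
    exact_mod_cast neg_le_neg (Real.logb_le_logb_of_le one_lt_two h0 h)

end Main

end SeqDecoding

open SeqDecoding

theorem mainTheorem2 {X d : Type*} [Fintype X] [DecidableEq X] [Nonempty X]
    [Fintype d] [DecidableEq d] (W : SeqDecoding.CQChannel X d) (ε ε' : ℝ)
    (hε : 0 ≤ ε) (hε' : 0 ≤ ε') (hlt : ε' < ε ^ 2 / 4) :
    ∃ D : EReal,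
      IsGreatest ((SeqDecoding.hypTestInformation W ε') '' stdSimplex ℝ X) D ∧
      D - ((Real.logb 2 (1 / (ε ^ 2 / 4 - ε')) : ℝ) : EReal)
        ≤ SeqDecoding.seqOneShotCapacity W ε ∧
      D - ((Real.logb 2 (1 / (ε ^ 2 / 4 - ε')) : ℝ) : EReal)
        ≤ SeqDecoding.oneShotCapacity W ε := by
  obtain ⟨p, hp, Q, hQ, hQρ, hβ, hmin⟩ := exists_optimal_test W hε'
  have hβ0 := trace_mul_marginals_nonneg W hp hQ
  have hcode := fun M hM => logb_le_seqOneShotCapacity W hε hp hQ hQρ (M := M) hM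
  rw [hβ] at hβ0 hcode
  suffices h : hypTestInformation W ε' p - ((Real.logb 2 (1 / (ε ^ 2 / 4 - ε')) : ℝ) : EReal)
      ≤ seqOneShotCapacity W ε by
    refine ⟨hypTestInformation W ε' p, ⟨⟨p, hp, rfl⟩, ?_⟩, h,
      h.trans (seqOneShotCapacity_le_oneShotCapacity W ε)⟩
    rintro _ ⟨q, hq, rfl⟩
    exact hypTestRelEntropy_le_of_beta_le hβ0 (hmin q hq)
  rw [hypTestInformation, hypTestRelEntropy]
  set β := beta ε' (cqState W p)
    (partialTraceRight (cqState W p) ⊗ₖ partialTraceLeft (cqState W p))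
  have hδ : 0 < ε ^ 2 / 4 - ε' := sub_pos.mpr hlt
  rcases hβ0.eq_or_lt with h0 | h0
  -- With β = 0 the condition on `M` reduces to ε' ≤ ε²/4, so the messages can number 2 ^ k for
  -- every k.
  · have htop : seqOneShotCapacity W ε = ⊤ := by
      rw [EReal.eq_top_iff_forall_lt]
      intro y
      obtain ⟨k, hk⟩ := exists_nat_gt y
      have h2 := hcode (2 ^ k) (by positivity) (by rw [← h0]; linarith)
      refine lt_of_lt_of_le ?_ h2
      rw [EReal.coe_lt_coe_iff]
      push_cast
      rwa [Real.logb_pow, Real.logb_self_eq_one one_lt_two, mul_one]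
    rw [htop]
    exact le_top
  · rw [if_neg h0.ne', ← EReal.coe_sub]
    have hx : 0 < (ε ^ 2 / 4 - ε') / β := div_pos hδ h0
    -- Rounding up is affordable because only M - 1 is multiplied by β: M - 1 < (ε²/4 - ε')/β, while
    -- log₂ M is at least the log of this quotient.
    refine le_trans ?_ (hcode ⌈(ε ^ 2 / 4 - ε') / β⌉₊ (Nat.ceil_pos.mpr hx) ?_)
    · rw [EReal.coe_le_coe_iff, one_div, Real.logb_inv, sub_neg_eq_add, neg_add_eq_sub,
        ← Real.logb_div hδ.ne' h0.ne']
      exact Real.logb_le_logb_of_le one_lt_two hx (Nat.le_ceil _)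
    · have h1 := Nat.ceil_lt_add_one hx.le
      have h2 := (lt_div_iff₀ h0).mp (sub_lt_iff_lt_add.mpr h1)
      linarith
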